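/- There is a universal constant $c>0$ such that the following holds for all integers $n,d,p\ge 1$ with $n\ge d$ and $p\ge 20n$, all real $\gamma\ge \frac{1}{\sqrt{nd}}$, all $\theta\in\mathbb{R}^d$ and all $W\in\mathbb{R}^{p\times d}$ with $W^\top W=p\gamma I_d$. Put $\Sigma=WW^\top+I_p$, $\beta=W(W^\top W+I_d)^{-1}\theta$ and $\sigma^2=\theta^\top(W^\top W+I_d)^{-1}\theta$. Let $A\in\mathbb{R}^{n\times p}$ be a random matrix whose rows are independent $\mathcal{N}(0,\Sigma)$ vectors, let $\epsilon\sim\mathcal{N}(0,\sigma^2 I_n)$ be independent of $A$, and let $y=A\beta+\epsilon$. For $b\in\mathbb{R}^p$ define the risk $$R(b)=\sigma^2+(b-\beta)^\top\Sigma\,(b-\beta).$$ Then, with probability at least $1-10e^{-cd}$, the matrix $AA^\top$ is invertible and the minimum-norm estimator $\hat\beta_A=A^\top(AA^\top)^{-1}y$ satisfies $$R(\hat\beta_A)\le\left(72\sqrt{\frac{d}{n}}+\frac{18n}{p}\right)\|\theta\|^2 .$$ -/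

import Mathlib

open MeasureTheory ProbabilityTheory Matrix

noncomputable section

namespace LatentRegression

/-- The covariance `Σ = W Wᵀ + I_p` of the observed features. -/
def covMatrix {d p : ℕ} (W : Matrix (Fin p) (Fin d) ℝ) : Matrix (Fin p) (Fin p) ℝ :=
  W * Wᵀ + 1

/-- The regression vector `β = W (Wᵀ W + I_d)⁻¹ θ`. -/
def trueParam {d p : ℕ} (W : Matrix (Fin p) (Fin d) ℝ) (θ : EuclideanSpace ℝ (Fin d)) :
    Fin p → ℝ :=
  W *ᵥ ((Wᵀ * W + 1)⁻¹ *ᵥ θ.ofLp)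

/-- The noise variance `σ² = θᵀ (Wᵀ W + I_d)⁻¹ θ`. -/
def noiseVar {d p : ℕ} (W : Matrix (Fin p) (Fin d) ℝ) (θ : EuclideanSpace ℝ (Fin d)) : ℝ :=
  θ.ofLp ⬝ᵥ ((Wᵀ * W + 1)⁻¹ *ᵥ θ.ofLp)

/-- The risk `R(b) = σ² + (b - β)ᵀ Σ (b - β)` of the linear predictor `x ↦ xᵀ b`. -/
def risk {d p : ℕ} (W : Matrix (Fin p) (Fin d) ℝ) (θ : EuclideanSpace ℝ (Fin d))
    (b : Fin p → ℝ) : ℝ :=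
  noiseVar W θ + (b - trueParam W θ) ⬝ᵥ (covMatrix W *ᵥ (b - trueParam W θ))

/-- The `n × p` data matrix with given rows. -/
def dataMatrix {n p : ℕ} (x : Fin n → EuclideanSpace ℝ (Fin p)) : Matrix (Fin n) (Fin p) ℝ :=
  Matrix.of fun i j => x i j

/-- The responses `y = A β + ε`. -/
def responses {n d p : ℕ} (W : Matrix (Fin p) (Fin d) ℝ) (θ : EuclideanSpace ℝ (Fin d))
    (A : Matrix (Fin n) (Fin p) ℝ) (ε : EuclideanSpace ℝ (Fin n)) : Fin n → ℝ :=
  A *ᵥ trueParam W θ + ε.ofLp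

/-- The minimum-norm estimator `Aᵀ (A Aᵀ)⁻¹ y` (meaningful when `A Aᵀ` is invertible). -/
def minNormEstimator {n p : ℕ} (A : Matrix (Fin n) (Fin p) ℝ) (y : Fin n → ℝ) : Fin p → ℝ :=
  Aᵀ *ᵥ ((A * Aᵀ)⁻¹ *ᵥ y)

/-- The random data of the single-task model: the rows `x i` of the data matrix are independent
`N(0, Σ)` vectors, and the noise `ε` is `N(0, σ² I_n)` and independent of the data matrix. -/
structure IsSingleTaskModel {Ω : Type*} [MeasurableSpace Ω] (P : Measure Ω) {n d p : ℕ}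
    (W : Matrix (Fin p) (Fin d) ℝ) (θ : EuclideanSpace ℝ (Fin d))
    (x : Fin n → Ω → EuclideanSpace ℝ (Fin p)) (ε : Ω → EuclideanSpace ℝ (Fin n)) : Prop where
  law_row : ∀ i, HasLaw (x i) (multivariateGaussian 0 (covMatrix W)) P
  indep_rows : iIndepFun x P
  law_noise : HasLaw ε (multivariateGaussian 0 (noiseVar W θ • (1 : Matrix (Fin n) (Fin n) ℝ))) P
  indep_noise : IndepFun (fun ω i => x i ω) ε P

end LatentRegression

end

/-! Write s = pγ and τ = ‖θ‖²/(1+s), so that σ² = τ and ‖β‖² ≤ τ. With e the estimation error, the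
risk is τ + ‖Wᵀe‖² + ‖e‖² (`risk_eq`), and on the event AAᵀ invertible the error satisfies Ae = ε.
Three events suffice: AΣ^(-1/2) has all singular values of order √p; AW, rescaled to standard
Gaussian columns, has singular values at least of order √n (needed only if 20d ≤ n); and ‖ε‖ ≤
(3/2)√(nτ). The first two come from one net argument, `measureReal_ill_conditioned_le`, the third
from a chi-square tail.

The rest is deterministic (`risk_minNormEstimator_le`). Min-norm interpolation of the noise costs
‖ε‖/√p up to a constant, and that of Aβ is an orthogonal projection of β, so ‖e‖ is O(√τ). Split e
along the range of W and its complement: since Ae = ε, the image AWWᵀe is s times the difference of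
ε and the image of the complementary part, of size O(√(pτ)). Conditioning of AW then gives ‖Wᵀe‖² =
O(pτ/n), and the lower bound on γ is exactly what makes pτ/n ≤ √(d/n)‖θ‖². If n < 20d, then √(d/n)
is bounded below and the crude estimate ‖Wᵀe‖² ≤ s‖e‖² is enough. The term √(d/n) absorbs
everything; 18n/p is slack. -/

namespace LatentRegression

/-! ### Nets on the sphere and extension of operator bounds -/

section Net

variable {E : Type*} [NormedAddCommGroup E] [NormedSpace ℝ E]

/-- Volumetric bound on the size of a separated subset of the unit ball. -/
theorem card_le_of_separated_unitBall [FiniteDimensional ℝ E] {δ : ℝ} (hδ : 0 < δ) (s : Finset E)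
    (hs : ∀ c ∈ s, ‖c‖ ≤ 1) (h : ∀ c ∈ s, ∀ d ∈ s, c ≠ d → δ ≤ ‖c - d‖) :
    (s.card : ℝ) ≤ (1 + 2 / δ) ^ Module.finrank ℝ E := by
  borelize E
  let μ : Measure E := Measure.addHaar
  have hr : 0 < δ / 2 := by positivity
  have hR : 0 < 1 + δ / 2 := by positivity
  have hdisj : Set.Pairwise (s : Set E)
      (Function.onFun Disjoint fun c => Metric.ball (c : E) (δ / 2)) := by
    rintro c hc d hd hcd
    apply Metric.ball_disjoint_ball
    rw [dist_eq_norm]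
    linarith [h c hc d hd hcd]
  have hsub : (⋃ c ∈ s, Metric.ball (c : E) (δ / 2)) ⊆ Metric.ball (0 : E) (1 + δ / 2) := by
    refine Set.iUnion₂_subset fun x hx => ?_
    apply Metric.ball_subset_ball'
    rw [dist_zero_right]
    linarith [hs x hx]
  have hvol : (s.card : ENNReal) * ENNReal.ofReal ((δ / 2) ^ Module.finrank ℝ E)
        * μ (Metric.ball 0 1) ≤
      ENNReal.ofReal ((1 + δ / 2) ^ Module.finrank ℝ E) * μ (Metric.ball 0 1) :=
    calc
      _ = μ (⋃ c ∈ s, Metric.ball (c : E) (δ / 2)) := by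
        rw [measure_biUnion_finset hdisj fun c _ => measurableSet_ball]
        simp only [μ.addHaar_ball_of_pos _ hr]
        simp only [Finset.sum_const, nsmul_eq_mul, mul_assoc]
      _ ≤ μ (Metric.ball (0 : E) (1 + δ / 2)) := measure_mono hsub
      _ = _ := by simp only [μ.addHaar_ball_of_pos _ hR]
  have hcancel : (s.card : ENNReal) * ENNReal.ofReal ((δ / 2) ^ Module.finrank ℝ E) ≤
      ENNReal.ofReal ((1 + δ / 2) ^ Module.finrank ℝ E) :=
    (ENNReal.mul_le_mul_iff_left (Metric.measure_ball_pos _ _ zero_lt_one).ne'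
      measure_ball_lt_top.ne).1 hvol
  have hreal := ENNReal.toReal_le_of_le_ofReal (pow_nonneg hR.le _) hcancel
  rw [ENNReal.toReal_mul, ENNReal.toReal_natCast,
    ENNReal.toReal_ofReal (pow_nonneg hr.le _)] at hreal
  have : (1 + 2 / δ) = (1 + δ / 2) / (δ / 2) := by field_simp; ring
  rw [this, div_pow, le_div_iff₀ (by positivity)]
  exact hreal

/-- The unit sphere has a finite `δ`-net of cardinality at most `(1 + 2 / δ) ^ dim E`. -/
theorem exists_net_unitSphere [FiniteDimensional ℝ E] {δ : ℝ} (hδ : 0 < δ) :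
    ∃ s : Finset E, (s.card : ℝ) ≤ (1 + 2 / δ) ^ Module.finrank ℝ E ∧ (∀ c ∈ s, ‖c‖ = 1) ∧
      ∀ v : E, ‖v‖ = 1 → ∃ c ∈ s, ‖v - c‖ ≤ δ := by
  classical
  let Sep : Finset E → Prop := fun s =>
    (∀ c ∈ s, ‖c‖ = 1) ∧ ∀ c ∈ s, ∀ d ∈ s, c ≠ d → δ ≤ ‖c - d‖
  have hcard : ∀ s, Sep s → (s.card : ℝ) ≤ (1 + 2 / δ) ^ Module.finrank ℝ E := fun s hs =>
    card_le_of_separated_unitBall hδ s (fun c hc => (hs.1 c hc).le) hs.2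
  let N : Set ℕ := {k | ∃ s, Sep s ∧ s.card = k}
  have hne : N.Nonempty := ⟨0, ∅, by simp [Sep], rfl⟩
  have hbdd : BddAbove N := by
    refine ⟨⌊(1 + 2 / δ) ^ Module.finrank ℝ E⌋₊, ?_⟩
    rintro k ⟨s, hs, rfl⟩
    exact Nat.le_floor (hcard s hs)
  -- A separated set of maximal cardinality is a net: a point far from all of it could be added.
  obtain ⟨s, hs, hsN⟩ := Nat.sSup_mem hne hbdd
  refine ⟨s, hcard s hs, hs.1, fun v hv => ?_⟩
  by_contra! hfar
  have hvs : v ∉ s := fun hmem => by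
    have := hfar v hmem
    simp only [sub_self, norm_zero] at this
    linarith
  have hins : Sep (insert v s) := by
    refine ⟨?_, ?_⟩
    · simpa [hv] using hs.1
    · intro c hc d hd hcd
      rcases Finset.mem_insert.1 hc with rfl | hc' <;> rcases Finset.mem_insert.1 hd with rfl | hd'
      · exact absurd rfl hcd
      · exact (hfar d hd').le
      · rw [norm_sub_rev]; exact (hfar c hc').le
      · exact hs.2 c hc' d hd' hcd
  have := le_csSup hbdd (show (insert v s).card ∈ N from ⟨_, hins, rfl⟩)
  rw [Finset.card_insert_of_notMem hvs, hsN] at this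
  omega

/-- Two-sided bounds for a linear map on a `δ`-net of the sphere extend to the whole space. -/
theorem norm_bounds_of_net {F : Type*} [NormedAddCommGroup F] [NormedSpace ℝ F]
    (L : E →L[ℝ] F) {δ a b : ℝ} (hδ : δ < 1) (hb : 0 ≤ b) (s : Finset E)
    (hs : ∀ v : E, ‖v‖ = 1 → ∃ c ∈ s, ‖v - c‖ ≤ δ)
    (hlow : ∀ c ∈ s, a ≤ ‖L c‖) (hupp : ∀ c ∈ s, ‖L c‖ ≤ b) (v : E) :
    (a - b / (1 - δ) * δ) * ‖v‖ ≤ ‖L v‖ ∧ ‖L v‖ ≤ b / (1 - δ) * ‖v‖ := by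
  rcases eq_or_ne v 0 with rfl | hv0
  · simp
  have hδ0 : 0 ≤ δ := by
    obtain ⟨c, -, hc⟩ := hs (‖v‖⁻¹ • v) (by rw [norm_smul, norm_inv, norm_norm,
      inv_mul_cancel₀ (norm_ne_zero_iff.2 hv0)])
    exact (norm_nonneg _).trans hc
  have key : ∀ w : E, ‖w‖ = 1 → ‖L w‖ ≤ b + ‖L‖ * δ := fun w hw => by
    obtain ⟨c, hc, hcw⟩ := hs w hw
    calc ‖L w‖ = ‖L c + L (w - c)‖ := by rw [← map_add]; congr 2; abel
      _ ≤ ‖L c‖ + ‖L (w - c)‖ := norm_add_le _ _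
      _ ≤ b + ‖L‖ * δ := add_le_add (hupp c hc)
        ((L.le_opNorm _).trans (mul_le_mul_of_nonneg_left hcw (norm_nonneg _)))
  -- The operator norm bounds itself; as it is finite and δ < 1, it can be absorbed on the left.
  have hnorm : ‖L‖ ≤ b + ‖L‖ * δ := by
    refine L.opNorm_le_bound (by positivity) fun w => ?_
    rcases eq_or_ne w 0 with rfl | hw
    · simp
    have hwn : 0 < ‖w‖ := norm_pos_iff.2 hw
    have := key (‖w‖⁻¹ • w) (by rw [norm_smul, norm_inv, norm_norm, inv_mul_cancel₀ hwn.ne'])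
    rw [map_smul, norm_smul, norm_inv, norm_norm, inv_mul_le_iff₀ hwn] at this
    linarith
  have hL : ‖L‖ ≤ b / (1 - δ) := by
    rw [le_div_iff₀ (by linarith)]; linarith
  refine ⟨?_, (L.le_opNorm v).trans (mul_le_mul_of_nonneg_right hL (norm_nonneg _))⟩
  have hvn : 0 < ‖v‖ := norm_pos_iff.2 hv0
  set w := ‖v‖⁻¹ • v with hw
  have hw1 : ‖w‖ = 1 := by rw [hw, norm_smul, norm_inv, norm_norm, inv_mul_cancel₀ hvn.ne']
  obtain ⟨c, hc, hcw⟩ := hs w hw1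
  have h1 : a ≤ ‖L w‖ + b / (1 - δ) * δ :=
    calc a ≤ ‖L c‖ := hlow c hc
      _ = ‖L w - L (w - c)‖ := by rw [← map_sub]; congr 2; abel
      _ ≤ ‖L w‖ + ‖L (w - c)‖ := norm_sub_le _ _
      _ ≤ ‖L w‖ + b / (1 - δ) * δ := by
        gcongr
        exact (L.le_opNorm _).trans (mul_le_mul hL hcw (norm_nonneg _) (by
          exact (norm_nonneg _).trans hL))
  have h2 : ‖L v‖ = ‖L w‖ * ‖v‖ := by
    rw [hw, map_smul, norm_smul, norm_inv, norm_norm]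
    field_simp
  rw [h2]
  exact mul_le_mul_of_nonneg_right (by linarith) hvn.le

end Net

/-! ### Chi-square moment generating function and tails -/

section ChiSquare

theorem gaussianReal_exp_mul_sq_aux (t x : ℝ) :
    gaussianPDFReal 0 1 x • Real.exp (t * x ^ 2) =
      (√(2 * Real.pi))⁻¹ * Real.exp (-(1 / 2 - t) * x ^ 2) := by
  rw [gaussianPDFReal_def]
  simp only [NNReal.coe_one, mul_one, sub_zero, smul_eq_mul]
  rw [mul_assoc, ← Real.exp_add]
  congr 2
  ring

theorem integral_exp_mul_sq_gaussianReal {t : ℝ} (ht : t < 1 / 2) :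
    ∫ x, Real.exp (t * x ^ 2) ∂(gaussianReal 0 1) = (√(1 - 2 * t))⁻¹ := by
  rw [integral_gaussianReal_eq_integral_smul one_ne_zero]
  simp_rw [gaussianReal_exp_mul_sq_aux]
  rw [integral_const_mul, integral_gaussian, ← Real.sqrt_inv, ← Real.sqrt_inv,
    ← Real.sqrt_mul (by positivity)]
  congr 1
  have : (1 / 2 - t) ≠ 0 := by linarith
  have : (1 - 2 * t) ≠ 0 := by linarith
  have := Real.pi_ne_zero
  field_simp

variable {N : ℕ}

theorem integral_exp_mul_norm_sq_stdGaussian {t : ℝ} (ht : t < 1 / 2) :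
    ∫ g, Real.exp (t * ‖g‖ ^ 2) ∂(stdGaussian (EuclideanSpace ℝ (Fin N))) =
      (√(1 - 2 * t))⁻¹ ^ N := by
  rw [← map_pi_eq_stdGaussian, integral_map (by fun_prop) (by fun_prop)]
  simp_rw [EuclideanSpace.real_norm_sq_eq, Finset.mul_sum, Real.exp_sum]
  rw [integral_fintype_prod_eq_prod (f := fun _ x => Real.exp (t * x ^ 2))]
  simp [integral_exp_mul_sq_gaussianReal ht]

theorem integrable_exp_mul_norm_sq_stdGaussian {t : ℝ} (ht : t < 1 / 2) :
    Integrable (fun g => Real.exp (t * ‖g‖ ^ 2)) (stdGaussian (EuclideanSpace ℝ (Fin N))) := by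
  -- A non-integrable function would have Bochner integral 0, but the computed value is positive.
  by_contra h
  have h1 := integral_undef h
  rw [integral_exp_mul_norm_sq_stdGaussian ht] at h1
  have : 0 < √(1 - 2 * t) := Real.sqrt_pos.2 (by linarith)
  exact absurd h1 (pow_pos (inv_pos.2 this) N).ne'

/-- Chernoff bound for ‖g‖² at level 9N/4. The exponent t = 5/18 is optimal there: 1 - 2t = 4/9. -/
theorem stdGaussian_norm_ge_le :
    (stdGaussian (EuclideanSpace ℝ (Fin N))).real {g | 3 / 2 * √N < ‖g‖} ≤
      (Real.exp (-5 / 8) * (3 / 2)) ^ N := by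
  have h := measure_ge_le_exp_mul_mgf (μ := stdGaussian (EuclideanSpace ℝ (Fin N)))
    (X := fun g => ‖g‖ ^ 2) (t := 5 / 18) (9 / 4 * N) (by norm_num)
    (integrable_exp_mul_norm_sq_stdGaussian (by norm_num))
  rw [mgf, integral_exp_mul_norm_sq_stdGaussian (by norm_num)] at h
  have hsq : √(1 - 2 * (5 / 18 : ℝ)) = 2 / 3 := by
    rw [Real.sqrt_eq_iff_mul_self_eq (by norm_num) (by norm_num)]; norm_num
  rw [hsq] at h
  refine (measureReal_mono fun g hg => ?_).trans (h.trans_eq ?_)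
  · simp only [Set.mem_ofPred_eq] at hg ⊢
    have h2 : (3 / 2 * √N) ^ 2 ≤ ‖g‖ ^ 2 := pow_le_pow_left₀ (by positivity) hg.le 2
    rw [mul_pow, Real.sq_sqrt (by positivity)] at h2
    linarith
  · rw [mul_pow, ← Real.exp_nat_mul]
    congr 2
    · ring
    · norm_num

/-- Chernoff bound at level 121N/400 with t = -3/2, for which √(1 - 2t) = 2. -/
theorem stdGaussian_norm_le_le :
    (stdGaussian (EuclideanSpace ℝ (Fin N))).real {g | ‖g‖ < 11 / 20 * √N} ≤
      (Real.exp (363 / 800) * (1 / 2)) ^ N := by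
  have h := measure_le_le_exp_mul_mgf (μ := stdGaussian (EuclideanSpace ℝ (Fin N)))
    (X := fun g => ‖g‖ ^ 2) (t := -3 / 2) (121 / 400 * N) (by norm_num)
    (integrable_exp_mul_norm_sq_stdGaussian (by norm_num))
  rw [mgf, integral_exp_mul_norm_sq_stdGaussian (by norm_num)] at h
  have hsq : √(1 - 2 * (-3 / 2 : ℝ)) = 2 := by
    rw [Real.sqrt_eq_iff_mul_self_eq (by norm_num) (by norm_num)]; norm_num
  rw [hsq] at h
  refine (measureReal_mono fun g hg => ?_).trans (h.trans_eq ?_)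
  · simp only [Set.mem_ofPred_eq] at hg ⊢
    have h2 : ‖g‖ ^ 2 ≤ (11 / 20 * √N) ^ 2 := pow_le_pow_left₀ (by positivity) hg.le 2
    rw [mul_pow, Real.sq_sqrt (by positivity)] at h2
    linarith
  · rw [mul_pow, ← Real.exp_nat_mul]
    congr 2
    · ring
    · norm_num

end ChiSquare

/-! ### Conditioning of tall Gaussian operators -/

section Tall

theorem exp_upper_const : 33 * (Real.exp (-5 / 8) * (3 / 2)) ^ 20 ≤ 1 / 2 := by
  rw [mul_pow, ← Real.exp_nat_mul]
  have : ((20 : ℕ) : ℝ) * (-5 / 8) = -(25 / 2) := by norm_num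
  rw [this, Real.exp_neg]
  have h1 : (2.7 : ℝ) ≤ Real.exp 1 := by linarith [Real.exp_one_gt_d9]
  have h3 : (1.64 : ℝ) ≤ Real.exp (1 / 2) := by
    have h4 : Real.exp (1 / 2) ^ 2 = Real.exp 1 := by rw [← Real.exp_nat_mul]; norm_num
    nlinarith [Real.exp_pos (1 / 2 : ℝ)]
  have h2 : (2.7 : ℝ) ^ 12 * 1.64 ≤ Real.exp (25 / 2) := by
    have : Real.exp (25 / 2) = Real.exp 1 ^ 12 * Real.exp (1 / 2) := by
      rw [← Real.exp_nat_mul, ← Real.exp_add]; norm_num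
    rw [this]
    gcongr
  rw [mul_comm, mul_assoc, inv_mul_le_iff₀ (Real.exp_pos _)]
  refine le_trans ?_ (mul_le_mul_of_nonneg_right h2 (by norm_num))
  norm_num

theorem exp_lower_const : 33 * (Real.exp (363 / 800) * (1 / 2)) ^ 20 ≤ 1 / 2 := by
  rw [mul_pow, ← Real.exp_nat_mul]
  have h : Real.exp (((20 : ℕ) : ℝ) * (363 / 800)) ≤ 2.72 ^ 9 * 1.1 := by
    have h1 : Real.exp 1 ≤ 2.72 := by linarith [Real.exp_one_lt_d9]
    have h2 : Real.exp (3 / 40) ≤ 1.1 := by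
      have h4 : Real.exp (3 / 40) ^ 40 ≤ 1.1 ^ 40 := by
        have : Real.exp (3 / 40) ^ 40 = Real.exp 1 ^ 3 := by
          rw [← Real.exp_nat_mul, ← Real.exp_nat_mul]; norm_num
        rw [this]
        refine (pow_le_pow_left₀ (Real.exp_pos 1).le h1 3).trans (by norm_num)
      exact le_of_pow_le_pow_left₀ (by norm_num) (by norm_num) h4
    have : Real.exp (((20 : ℕ) : ℝ) * (363 / 800)) = Real.exp 1 ^ 9 * Real.exp (3 / 40) := by
      rw [← Real.exp_nat_mul, ← Real.exp_add]; norm_num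
    rw [this]
    gcongr
  have := mul_le_mul_of_nonneg_right h (show (0 : ℝ) ≤ (1 / 2) ^ 20 by norm_num)
  refine (mul_le_mul_of_nonneg_left this (by norm_num)).trans ?_
  norm_num

/-- The union bound over a net of 33^m points: each dimension of the domain is paid for by twenty
dimensions of the target. -/
theorem pow_mul_pow_le_half_pow {r : ℝ} (hr0 : 0 ≤ r) (hr : 33 * r ^ 20 ≤ 1 / 2) {m N : ℕ}
    (h : 20 * m ≤ N) : (33 : ℝ) ^ m * r ^ N ≤ (1 / 2) ^ m := by
  have hr1 : r ≤ 1 := by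
    by_contra! hlt
    have := one_le_pow₀ (n := 20) hlt.le
    linarith
  calc (33 : ℝ) ^ m * r ^ N ≤ 33 ^ m * r ^ (20 * m) := by
        gcongr ?_ * ?_
        exact pow_le_pow_of_le_one hr0 hr1 h
    _ = (33 * r ^ 20) ^ m := by rw [mul_pow, ← pow_mul]
    _ ≤ (1 / 2) ^ m := pow_le_pow_left₀ (by positivity) hr m

/-- A tall Gaussian random operator is well conditioned with overwhelming probability. -/
theorem measureReal_ill_conditioned_le {Ω : Type*} [MeasurableSpace Ω] (P : Measure Ω)
    [IsProbabilityMeasure P] {m N : ℕ} (hmN : 20 * m ≤ N)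
    (L : Ω → EuclideanSpace ℝ (Fin m) →L[ℝ] EuclideanSpace ℝ (Fin N))
    (hL : ∀ v, ‖v‖ = 1 →
      HasLaw (fun ω => L ω v) (stdGaussian (EuclideanSpace ℝ (Fin N))) P) :
    P.real {ω | ¬ ∀ v, 9 / 20 * √N * ‖v‖ ≤ ‖L ω v‖ ∧ ‖L ω v‖ ≤ 8 / 5 * √N * ‖v‖} ≤
      2 * (1 / 2) ^ m := by
  obtain ⟨s, hcard, hs1, hnet⟩ :=
    -- For δ = 1/16 the net has at most 33^m points, and net bounds 11/20 and 3/2 become (3/2)/(1 -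
    -- δ) = 8/5 and 11/20 - (8/5)δ = 9/20.
    exists_net_unitSphere (E := EuclideanSpace ℝ (Fin m)) (δ := 1 / 16) (by norm_num)
  have hcard' : (s.card : ℝ) ≤ 33 ^ m := by
    rw [finrank_euclideanSpace_fin] at hcard
    refine hcard.trans_eq ?_
    norm_num
  have hsub : {ω | ¬ ∀ v, 9 / 20 * √N * ‖v‖ ≤ ‖L ω v‖ ∧ ‖L ω v‖ ≤ 8 / 5 * √N * ‖v‖} ⊆
      ⋃ c ∈ s, ({ω | 3 / 2 * √N < ‖L ω c‖} ∪ {ω | ‖L ω c‖ < 11 / 20 * √N}) := by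
    intro ω hω
    by_contra hcon
    simp only [Set.mem_iUnion, Set.mem_union, Set.mem_ofPred_eq, not_exists, not_or,
      not_lt] at hcon
    refine hω fun v => ?_
    have := norm_bounds_of_net (L ω) (δ := 1 / 16) (a := 11 / 20 * √N) (b := 3 / 2 * √N)
      (by norm_num) (by positivity) s hnet (fun c hc => (hcon c hc).2)
      (fun c hc => (hcon c hc).1) v
    convert this using 3 <;> ring
  have hup : ∀ c ∈ s, P.real {ω | 3 / 2 * √N < ‖L ω c‖} ≤ (Real.exp (-5 / 8) * (3 / 2)) ^ N :=
    fun c hc => by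
      rw [(hL c (hs1 c hc)).measureReal_eq (p := fun g => 3 / 2 * √N < ‖g‖)
        (measurableSet_lt measurable_const measurable_norm)]
      exact stdGaussian_norm_ge_le
  have hlow : ∀ c ∈ s, P.real {ω | ‖L ω c‖ < 11 / 20 * √N} ≤
      (Real.exp (363 / 800) * (1 / 2)) ^ N :=
    fun c hc => by
      rw [(hL c (hs1 c hc)).measureReal_eq (p := fun g => ‖g‖ < 11 / 20 * √N)
        (measurableSet_lt measurable_norm measurable_const)]
      exact stdGaussian_norm_le_le
  calc _ ≤ P.real (⋃ c ∈ s, ({ω | 3 / 2 * √N < ‖L ω c‖} ∪ {ω | ‖L ω c‖ < 11 / 20 * √N})) :=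
        measureReal_mono hsub (measure_ne_top _ _)
    _ ≤ ∑ c ∈ s, P.real ({ω | 3 / 2 * √N < ‖L ω c‖} ∪ {ω | ‖L ω c‖ < 11 / 20 * √N}) :=
        measureReal_biUnion_finset_le _ _
    _ ≤ ∑ c ∈ s, ((Real.exp (-5 / 8) * (3 / 2)) ^ N + (Real.exp (363 / 800) * (1 / 2)) ^ N) :=
        Finset.sum_le_sum fun c hc =>
          (measureReal_union_le _ _).trans (add_le_add (hup c hc) (hlow c hc))
    _ = s.card * ((Real.exp (-5 / 8) * (3 / 2)) ^ N + (Real.exp (363 / 800) * (1 / 2)) ^ N) := by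
        rw [Finset.sum_const, nsmul_eq_mul]
    _ ≤ 33 ^ m * ((Real.exp (-5 / 8) * (3 / 2)) ^ N + (Real.exp (363 / 800) * (1 / 2)) ^ N) := by
        gcongr
    _ ≤ 2 * (1 / 2) ^ m := by
        have h1 := pow_mul_pow_le_half_pow (by positivity) exp_upper_const hmN
        have h2 := pow_mul_pow_le_half_pow (by positivity) exp_lower_const hmN
        linarith

end Tall

/-! ### Euclidean norm of coordinate vectors -/

section Euclidean

variable {k : ℕ}

/-- The Euclidean norm of a plain coordinate vector. -/
noncomputable def l2 (v : Fin k → ℝ) : ℝ := ‖WithLp.toLp 2 v‖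

theorem l2_nonneg (v : Fin k → ℝ) : 0 ≤ l2 v := norm_nonneg _

theorem l2_sq (v : Fin k → ℝ) : l2 v ^ 2 = v ⬝ᵥ v := by
  rw [l2, EuclideanSpace.real_norm_sq_eq]
  simp [dotProduct, sq]

theorem l2_eq_zero {v : Fin k → ℝ} : l2 v = 0 ↔ v = 0 := by
  rw [l2, norm_eq_zero, WithLp.toLp_eq_zero]

theorem l2_smul (a : ℝ) (v : Fin k → ℝ) : l2 (a • v) = |a| * l2 v := by
  rw [l2, WithLp.toLp_smul, norm_smul, Real.norm_eq_abs, l2]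

theorem l2_sub_le (v w : Fin k → ℝ) : l2 (v - w) ≤ l2 v + l2 w := by
  rw [l2, WithLp.toLp_sub]; exact norm_sub_le _ _

theorem dotProduct_le_l2_mul_l2 (v w : Fin k → ℝ) : v ⬝ᵥ w ≤ l2 v * l2 w := by
  have h := real_inner_le_norm (WithLp.toLp 2 w) (WithLp.toLp 2 v)
  rw [EuclideanSpace.inner_toLp_toLp, star_trivial] at h
  rw [mul_comm]
  exact h

end Euclidean

/-! ### Error of minimum-norm interpolation -/

section MinNorm

variable {n p : ℕ}

theorem l2_sq_transpose_mulVec (A : Matrix (Fin n) (Fin p) ℝ) (v : Fin n → ℝ) :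
    l2 (Aᵀ *ᵥ v) ^ 2 = v ⬝ᵥ ((A * Aᵀ) *ᵥ v) := by
  rw [l2_sq, ← Matrix.mulVec_mulVec, Matrix.dotProduct_mulVec v A, Matrix.mulVec_transpose]

theorem isUnit_mul_transpose_of_le_l2 {A : Matrix (Fin n) (Fin p) ℝ} {a : ℝ} (ha : 0 < a)
    (h : ∀ v, a * l2 v ≤ l2 (Aᵀ *ᵥ v)) : IsUnit (A * Aᵀ) := by
  rw [← Matrix.mulVec_injective_iff_isUnit]
  refine (injective_iff_map_eq_zero (A * Aᵀ).mulVecLin).2 fun v hv => ?_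
  rw [Matrix.mulVecLin_apply] at hv
  have h0 : l2 (Aᵀ *ᵥ v) ^ 2 = 0 := by
    rw [l2_sq_transpose_mulVec, hv, dotProduct_zero]
  have h1 := h v
  rw [pow_eq_zero_iff two_ne_zero |>.1 h0] at h1
  have := l2_nonneg v
  exact l2_eq_zero.1 (by nlinarith)

theorem mulVec_minNormEstimator {A : Matrix (Fin n) (Fin p) ℝ} (hA : IsUnit (A * Aᵀ))
    (y : Fin n → ℝ) : A *ᵥ minNormEstimator A y = y := by
  rw [minNormEstimator, Matrix.mulVec_mulVec, Matrix.mulVec_mulVec,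
    Matrix.mul_nonsing_inv _ ((Matrix.isUnit_iff_isUnit_det _).1 hA), Matrix.one_mulVec]

/-- With u = (AAᵀ)⁻¹ε, ‖Aᵀu‖² = ⟨u, ε⟩ ≤ ‖u‖‖ε‖ ≤ ‖Aᵀu‖‖ε‖/a. -/
theorem l2_minNormEstimator_le {A : Matrix (Fin n) (Fin p) ℝ} {a : ℝ} (ha : 0 < a)
    (h : ∀ v, a * l2 v ≤ l2 (Aᵀ *ᵥ v)) (ε : Fin n → ℝ) :
    l2 (minNormEstimator A ε) ≤ l2 ε / a := by
  have hA := isUnit_mul_transpose_of_le_l2 ha h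
  set u := (A * Aᵀ)⁻¹ *ᵥ ε with hu
  have hAu : (A * Aᵀ) *ᵥ u = ε := by
    rw [hu, Matrix.mulVec_mulVec,
      Matrix.mul_nonsing_inv _ ((Matrix.isUnit_iff_isUnit_det _).1 hA), Matrix.one_mulVec]
  change l2 (Aᵀ *ᵥ u) ≤ _
  have h1 : l2 (Aᵀ *ᵥ u) ^ 2 ≤ l2 u * l2 ε := by
    rw [l2_sq_transpose_mulVec, hAu]; exact dotProduct_le_l2_mul_l2 _ _
  have h2 := h u
  rw [le_div_iff₀ ha]
  rcases (l2_nonneg (Aᵀ *ᵥ u)).eq_or_lt with h0 | h0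
  · rw [← h0, zero_mul]; exact l2_nonneg _
  · have := l2_nonneg ε
    refine le_of_mul_le_mul_left ?_ h0
    nlinarith

/-- Without noise the estimator is the orthogonal projection of β onto the row space of A, so
Pythagoras applies. -/
theorem l2_sub_minNormEstimator_mulVec_le {A : Matrix (Fin n) (Fin p) ℝ} (hA : IsUnit (A * Aᵀ))
    (β : Fin p → ℝ) : l2 (β - minNormEstimator A (A *ᵥ β)) ≤ l2 β := by
  have hfit := mulVec_minNormEstimator hA (A *ᵥ β)
  set b := minNormEstimator A (A *ᵥ β) with hb
  have horth : b ⬝ᵥ (β - b) = 0 := by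
    have : A *ᵥ (β - b) = 0 := by rw [Matrix.mulVec_sub, hfit, sub_self]
    have hb' : b = ((A * Aᵀ)⁻¹ *ᵥ (A *ᵥ β)) ᵥ* A := by
      rw [hb, minNormEstimator, Matrix.mulVec_transpose]
    generalize (A * Aᵀ)⁻¹ *ᵥ (A *ᵥ β) = w at hb'
    nth_rewrite 1 [hb']
    rw [← Matrix.dotProduct_mulVec, this, dotProduct_zero]
  have hpyth : l2 β ^ 2 = l2 b ^ 2 + l2 (β - b) ^ 2 := by
    simp only [l2_sq]
    have : β = b + (β - b) := by abel
    conv_lhs => rw [this]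
    rw [add_dotProduct, dotProduct_add, dotProduct_add, horth, dotProduct_comm (β - b) b, horth]
    ring
  exact abs_le_of_sq_le_sq' (by nlinarith [sq_nonneg (l2 b)]) (l2_nonneg _) |>.2

/-- The estimation error of the minimum-norm interpolator of noisy linear data. -/
theorem l2_minNormEstimator_sub_le {A : Matrix (Fin n) (Fin p) ℝ} {a : ℝ} (ha : 0 < a)
    (h : ∀ v, a * l2 v ≤ l2 (Aᵀ *ᵥ v)) (β : Fin p → ℝ) (ε : Fin n → ℝ) :
    l2 (minNormEstimator A (A *ᵥ β + ε) - β) ≤ l2 ε / a + l2 β := by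
  have hA := isUnit_mul_transpose_of_le_l2 ha h
  have : minNormEstimator A (A *ᵥ β + ε) - β =
      minNormEstimator A ε - (β - minNormEstimator A (A *ᵥ β)) := by
    simp only [minNormEstimator, Matrix.mulVec_add]
    abel
  rw [this]
  exact (l2_sub_le _ _).trans (add_le_add (l2_minNormEstimator_le ha h ε)
    (l2_sub_minNormEstimator_mulVec_le hA β))

end MinNorm

/-! ### Deterministic risk bounds when W has orthogonal columns -/

section Orthogonal

variable {d p : ℕ} {W : Matrix (Fin p) (Fin d) ℝ} {s : ℝ}

theorem inv_gram_add_one (hW : Wᵀ * W = s • 1) (hs : 0 < s) :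
    (Wᵀ * W + 1)⁻¹ = (1 + s)⁻¹ • (1 : Matrix (Fin d) (Fin d) ℝ) := by
  apply Matrix.inv_eq_left_inv
  rw [hW, Matrix.smul_mul, Matrix.one_mul]
  have : (s • 1 + 1 : Matrix (Fin d) (Fin d) ℝ) = (1 + s) • 1 := by
    rw [add_smul, one_smul, add_comm]
  rw [this, smul_smul, inv_mul_cancel₀ (by positivity), one_smul]

theorem noiseVar_eq (hW : Wᵀ * W = s • 1) (hs : 0 < s) (θ : EuclideanSpace ℝ (Fin d)) :
    noiseVar W θ = ‖θ‖ ^ 2 / (1 + s) := by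
  rw [noiseVar, inv_gram_add_one hW hs, Matrix.smul_mulVec, Matrix.one_mulVec, dotProduct_smul,
    ← l2_sq, smul_eq_mul, inv_mul_eq_div]
  rfl

theorem l2_mulVec_sq (hW : Wᵀ * W = s • 1) (u : Fin d → ℝ) : l2 (W *ᵥ u) ^ 2 = s * l2 u ^ 2 := by
  have := l2_sq_transpose_mulVec Wᵀ u
  rw [Matrix.transpose_transpose, hW, Matrix.smul_mulVec, Matrix.one_mulVec, dotProduct_smul,
    ← l2_sq] at this
  exact this

/-- By Cauchy–Schwarz, ‖Wᵀb‖² = ⟨b, WWᵀb⟩ ≤ ‖b‖‖WWᵀb‖ = √s ‖b‖‖Wᵀb‖. -/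
theorem l2_transpose_mulVec_sq_le (hW : Wᵀ * W = s • 1) (hs : 0 < s) (b : Fin p → ℝ) :
    l2 (Wᵀ *ᵥ b) ^ 2 ≤ s * l2 b ^ 2 := by
  have h1 : l2 (Wᵀ *ᵥ b) ^ 2 ≤ l2 b * l2 (W *ᵥ (Wᵀ *ᵥ b)) := by
    rw [l2_sq_transpose_mulVec, ← Matrix.mulVec_mulVec]
    exact dotProduct_le_l2_mul_l2 _ _
  have h2 := l2_mulVec_sq hW (Wᵀ *ᵥ b)
  have h3 : (l2 (Wᵀ *ᵥ b) ^ 2) ^ 2 ≤ (s * l2 b ^ 2) * l2 (Wᵀ *ᵥ b) ^ 2 :=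
    calc _ ≤ (l2 b * l2 (W *ᵥ (Wᵀ *ᵥ b))) ^ 2 := pow_le_pow_left₀ (by positivity) h1 2
      _ = _ := by rw [mul_pow, h2]; ring
  rcases (sq_nonneg (l2 (Wᵀ *ᵥ b))).eq_or_lt with h0 | h0
  · rw [← h0]; positivity
  · exact le_of_mul_le_mul_right (by rwa [← sq]) h0

theorem l2_trueParam_sq_le (hW : Wᵀ * W = s • 1) (hs : 0 < s) (θ : EuclideanSpace ℝ (Fin d)) :
    l2 (trueParam W θ) ^ 2 ≤ ‖θ‖ ^ 2 / (1 + s) := by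
  rw [trueParam, l2_mulVec_sq hW, inv_gram_add_one hW hs, Matrix.smul_mulVec, Matrix.one_mulVec,
    l2_smul, abs_of_pos (by positivity)]
  change s * ((1 + s)⁻¹ * ‖θ‖) ^ 2 ≤ _
  rw [mul_pow, inv_pow, div_eq_mul_inv]
  have : s * ((1 + s) ^ 2)⁻¹ ≤ (1 + s)⁻¹ := by
    rw [← div_eq_mul_inv, ← one_div, div_le_div_iff₀ (by positivity) (by positivity)]
    nlinarith
  nlinarith [mul_le_mul_of_nonneg_right this (sq_nonneg ‖θ‖)]

theorem risk_eq (θ : EuclideanSpace ℝ (Fin d)) (b : Fin p → ℝ) :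
    risk W θ b = noiseVar W θ + l2 (Wᵀ *ᵥ (b - trueParam W θ)) ^ 2 +
      l2 (b - trueParam W θ) ^ 2 := by
  rw [risk, covMatrix, Matrix.add_mulVec, Matrix.one_mulVec, dotProduct_add,
    l2_sq_transpose_mulVec, l2_sq, add_assoc]

/-- The risk bound when nothing is known about the design along the range of `W`. -/
theorem risk_le_of_coarse (hW : Wᵀ * W = s • 1) (hs : 0 < s) (θ : EuclideanSpace ℝ (Fin d))
    (b : Fin p → ℝ) (hb : l2 (b - trueParam W θ) ^ 2 ≤ 49 / 16 * (‖θ‖ ^ 2 / (1 + s))) :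
    risk W θ b ≤ 5 * ‖θ‖ ^ 2 := by
  have hτ : ‖θ‖ ^ 2 / (1 + s) * (1 + s) = ‖θ‖ ^ 2 := div_mul_cancel₀ _ (by positivity)
  have hτ0 : 0 ≤ ‖θ‖ ^ 2 / (1 + s) := by positivity
  have h1 := l2_transpose_mulVec_sq_le hW hs (b - trueParam W θ)
  have h2 := mul_le_mul_of_nonneg_left hb hs.le
  rw [risk_eq, noiseVar_eq hW hs]
  nlinarith

/-- An interpolation error `e` has a small image under `Wᵀ` if the design is well conditioned along
the range of `W` and bounded on its orthogonal complement. -/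
theorem l2_transpose_mulVec_le_of_mulVec_eq {n : ℕ} {A : Matrix (Fin n) (Fin p) ℝ} {a K : ℝ}
    (hs : 0 < s) (hlow : ∀ u, a * √(s * (1 + s)) * l2 u ≤ l2 (A *ᵥ (W *ᵥ u)))
    (ha : 0 ≤ a) (hupp : ∀ b, l2 (A *ᵥ (b - s⁻¹ • (W *ᵥ (Wᵀ *ᵥ b)))) ≤ K * l2 b)
    {e : Fin p → ℝ} {ε : Fin n → ℝ} (he : A *ᵥ e = ε) :
    a * l2 (Wᵀ *ᵥ e) ≤ l2 ε + K * l2 e := by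
  have h1 := hlow (Wᵀ *ᵥ e)
  -- s⁻¹WWᵀ projects onto the range of W, so the interpolation equation determines the image of the
  -- signal part of e from that of its complement.
  have h2 : A *ᵥ (W *ᵥ (Wᵀ *ᵥ e)) = s • (ε - A *ᵥ (e - s⁻¹ • (W *ᵥ (Wᵀ *ᵥ e)))) := by
    rw [Matrix.mulVec_sub, he, Matrix.mulVec_smul, sub_sub_cancel, smul_smul,
      mul_inv_cancel₀ hs.ne', one_smul]
  rw [h2, l2_smul, abs_of_pos hs] at h1
  have h3 := (l2_sub_le ε (A *ᵥ (e - s⁻¹ • (W *ᵥ (Wᵀ *ᵥ e))))).trans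
    (add_le_add_right (hupp e) _)
  have h4 : s ≤ √(s * (1 + s)) := Real.le_sqrt_of_sq_le (by nlinarith)
  have h5 : s * (a * l2 (Wᵀ *ᵥ e)) ≤ √(s * (1 + s)) * (a * l2 (Wᵀ *ᵥ e)) :=
    mul_le_mul_of_nonneg_right h4 (mul_nonneg ha (l2_nonneg _))
  have h6 := mul_le_mul_of_nonneg_left h3 hs.le
  exact le_of_mul_le_mul_left (by linarith) hs

/-- This is where the lower bound on γ enters: s ≥ p/√(nd), and √(d/n)·(n/p) is the reciprocal of
p/√(nd). -/
theorem div_one_add_le_sqrt {n d p : ℕ} {s γ : ℝ} (hd : 0 < d) (hn : 0 < n) (hp : 0 < p)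
    (hγ : 1 / √((n : ℝ) * d) ≤ γ) (hs : s = p * γ) (x : ℝ) :
    x ^ 2 / (1 + s) ≤ √((d : ℝ) / n) * (n / p) * x ^ 2 := by
  have hn' : (0 : ℝ) < n := by exact_mod_cast hn
  have hd' : (0 : ℝ) < d := by exact_mod_cast hd
  have hp' : (0 : ℝ) < p := by exact_mod_cast hp
  have hnd : 0 < √((n : ℝ) * d) := Real.sqrt_pos.2 (by positivity)
  have hs1 : p / √((n : ℝ) * d) ≤ s := by
    rw [hs, div_eq_mul_one_div]; exact mul_le_mul_of_nonneg_left hγ hp'.le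
  have hprod : √((d : ℝ) / n) * (n / p) * (p / √((n : ℝ) * d)) = 1 := by
    have hd2 := Real.sq_sqrt hd'.le
    have hn2 := Real.sq_sqrt hn'.le
    have := Real.sqrt_pos.2 hn'
    have := Real.sqrt_pos.2 hd'
    rw [Real.sqrt_div hd'.le, Real.sqrt_mul hn'.le]
    field_simp
    rw [hn2]
  have hone : 1 ≤ √((d : ℝ) / n) * (n / p) * (1 + s) := by
    rw [← hprod]
    exact mul_le_mul_of_nonneg_left (by linarith) (by positivity)
  have hs0 : 0 < s := lt_of_lt_of_le (by positivity) hs1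
  rw [div_le_iff₀ (by positivity)]
  nlinarith [mul_le_mul_of_nonneg_right hone (sq_nonneg x)]

/-- Deterministic risk bound for the minimum-norm estimator under a well-conditioned design. -/
theorem risk_minNormEstimator_le {n d p : ℕ} {W : Matrix (Fin p) (Fin d) ℝ} {s γ : ℝ}
    (hd : 0 < d) (hdn : d ≤ n) (hnp : 20 * n ≤ p) (hγ : 1 / √((n : ℝ) * d) ≤ γ)
    (hs : s = p * γ) (hW : Wᵀ * W = s • 1) (θ : EuclideanSpace ℝ (Fin d))
    {A : Matrix (Fin n) (Fin p) ℝ} {ε : Fin n → ℝ}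
    (hA : ∀ v, 9 / 20 * √p * l2 v ≤ l2 (Aᵀ *ᵥ v))
    (hε : l2 ε ≤ 3 / 2 * √n * √(‖θ‖ ^ 2 / (1 + s)))
    (hlow : 20 * d ≤ n → ∀ u, 9 / 20 * √n * √(s * (1 + s)) * l2 u ≤ l2 (A *ᵥ (W *ᵥ u)))
    (hupp : ∀ b, l2 (A *ᵥ (b - s⁻¹ • (W *ᵥ (Wᵀ *ᵥ b)))) ≤ 8 / 5 * √p * l2 b) :
    risk W θ (minNormEstimator A (responses W θ A (WithLp.toLp 2 ε))) ≤
      (72 * √((d : ℝ) / n) + 18 * n / p) * ‖θ‖ ^ 2 := by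
  have hn : 0 < n := hd.trans_le hdn
  have hp : 0 < p := by omega
  have hn' : (0 : ℝ) < n := by exact_mod_cast hn
  have hd' : (0 : ℝ) < d := by exact_mod_cast hd
  have hp' : (0 : ℝ) < p := by exact_mod_cast hp
  have hnp' : 20 * (n : ℝ) ≤ p := by exact_mod_cast hnp
  have hs0 : 0 < s := by
    rw [hs]
    exact mul_pos hp' (lt_of_lt_of_le (by positivity) hγ)
  have hτle := div_one_add_le_sqrt hd hn hp hγ hs ‖θ‖
  have hβ := l2_trueParam_sq_le hW hs0 θ
  have hnoise := noiseVar_eq hW hs0 θ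
  have hcoarse := risk_le_of_coarse hW hs0 θ
    (minNormEstimator A (responses W θ A (WithLp.toLp 2 ε)))
  set τ := ‖θ‖ ^ 2 / (1 + s) with hτ
  have hτ0 : 0 ≤ τ := by positivity
  set r := √((d : ℝ) / n) with hr
  have hr0 : 0 < r := Real.sqrt_pos.2 (by positivity)
  have hextra : 0 ≤ 18 * (n : ℝ) / p * ‖θ‖ ^ 2 := by positivity
  have hsp : 0 < √(p : ℝ) := Real.sqrt_pos.2 hp'
  have hsn : 0 < √(n : ℝ) := Real.sqrt_pos.2 hn'
  -- From n ≤ p/20, since 1/20 ≤ (9/40)². The noise then contributes (27/80)/(9/20) = 3/4 to the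
  -- constant 7/4 bounding ‖e‖/√τ.
  have hsnp : √(n : ℝ) ≤ 9 / 40 * √p := by
    rw [Real.sqrt_le_left (by positivity), mul_pow, Real.sq_sqrt hp'.le]
    linarith
  have hst : 0 ≤ √τ := Real.sqrt_nonneg _
  have hβ' : l2 (trueParam W θ) ≤ √τ := Real.le_sqrt_of_sq_le hβ
  set e := minNormEstimator A (responses W θ A (WithLp.toLp 2 ε)) - trueParam W θ with he
  have hAe : A *ᵥ e = ε := by
    rw [he, Matrix.mulVec_sub, mulVec_minNormEstimator
      (isUnit_mul_transpose_of_le_l2 (by positivity) hA), responses, add_sub_cancel_left]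
  have hεp : l2 ε ≤ 27 / 80 * √p * √τ :=
    hε.trans (mul_le_mul_of_nonneg_right (by linarith) hst)
  have hebound : l2 e ≤ 7 / 4 * √τ := by
    refine (l2_minNormEstimator_sub_le (by positivity) hA _ _).trans ?_
    have : l2 ε / (9 / 20 * √p) ≤ 3 / 4 * √τ := by
      rw [div_le_iff₀ (by positivity)]
      linarith
    exact (add_le_add this hβ').trans_eq (by ring)
  have hesq : l2 e ^ 2 ≤ 49 / 16 * τ := by
    refine (pow_le_pow_left₀ (l2_nonneg _) hebound 2).trans_eq ?_
    rw [mul_pow, Real.sq_sqrt hτ0]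
    norm_num
  rcases le_or_gt (20 * d) n with hdn20 | hdn20
  · have hWe := l2_transpose_mulVec_le_of_mulVec_eq hs0 (hlow hdn20) (by positivity) hupp hAe
    -- (27/80 + (8/5)(7/4))/(9/20) is just below 7. The risk constant becomes 1 + 49 + 49/16 < 72.
    have hWe' : √n * l2 (Wᵀ *ᵥ e) ≤ 7 * (√p * √τ) := by
      have := mul_le_mul_of_nonneg_left hebound (show 0 ≤ 8 / 5 * √(p : ℝ) by positivity)
      have : 0 ≤ √(p : ℝ) * √τ := by positivity
      nlinarith
    have hWsq : l2 (Wᵀ *ᵥ e) ^ 2 * n ≤ 49 * (p * τ) := by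
      have := pow_le_pow_left₀ (mul_nonneg hsn.le (l2_nonneg _)) hWe' 2
      rw [mul_pow, mul_pow, mul_pow, Real.sq_sqrt hτ0, Real.sq_sqrt hn'.le,
        Real.sq_sqrt hp'.le] at this
      linarith
    have hpτ : p * τ ≤ r * n * ‖θ‖ ^ 2 := by
      have := mul_le_mul_of_nonneg_left hτle hp'.le
      refine this.trans_eq ?_
      field_simp
    have hWfin : l2 (Wᵀ *ᵥ e) ^ 2 ≤ 49 * (r * ‖θ‖ ^ 2) :=
      le_of_mul_le_mul_right (by linarith) hn'
    have hτfin : τ ≤ r * ‖θ‖ ^ 2 := by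
      have : (n : ℝ) / p ≤ 1 := by rw [div_le_one hp']; linarith
      have h2 := mul_le_mul_of_nonneg_left this (show 0 ≤ r * ‖θ‖ ^ 2 by positivity)
      linarith
    rw [risk_eq, hnoise, ← he]
    have : 0 ≤ r * ‖θ‖ ^ 2 := by positivity
    linarith
  · refine (hcoarse hesq).trans ?_
    have hr5 : 5 ≤ 72 * r := by
      have : 5 / 72 ≤ r := by
        apply Real.le_sqrt_of_sq_le
        rw [le_div_iff₀ hn']
        have : (n : ℝ) ≤ 20 * d := by exact_mod_cast hdn20.le
        linarith
      linarith
    nlinarith [mul_le_mul_of_nonneg_right hr5 (sq_nonneg ‖θ‖)]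

end Orthogonal

/-! ### Gaussian laws of linear images and of the noise -/

section Laws

variable {Ω : Type*} [MeasurableSpace Ω] {P : Measure Ω}

theorem charFun_map_continuousLinearMap {E F : Type*} [NormedAddCommGroup E]
    [InnerProductSpace ℝ E] [CompleteSpace E] [MeasurableSpace E] [BorelSpace E]
    [NormedAddCommGroup F] [InnerProductSpace ℝ F] [CompleteSpace F] [MeasurableSpace F]
    [BorelSpace F] [SecondCountableTopology F] (μ : Measure E) (L : E →L[ℝ] F) (t : F) :
    charFun (μ.map L) t = charFun μ (L.adjoint t) := by
  rw [charFun_apply, charFun_apply, integral_map (by fun_prop)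
    (Continuous.aestronglyMeasurable (by fun_prop))]
  simp_rw [ContinuousLinearMap.adjoint_inner_right]

/-- The continuous linear map between Euclidean spaces given by a matrix. -/
noncomputable def matrixCLM {k m : ℕ} (M : Matrix (Fin k) (Fin m) ℝ) :
    EuclideanSpace ℝ (Fin m) →L[ℝ] EuclideanSpace ℝ (Fin k) :=
  LinearMap.toContinuousLinearMap (toEuclideanLin M)

theorem matrixCLM_apply {k m : ℕ} (M : Matrix (Fin k) (Fin m) ℝ)
    (v : EuclideanSpace ℝ (Fin m)) : matrixCLM M v = WithLp.toLp 2 (M *ᵥ v.ofLp) := rfl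

theorem inner_eq_dotProduct_ofLp {k : ℕ} (v w : EuclideanSpace ℝ (Fin k)) :
    inner ℝ v w = v.ofLp ⬝ᵥ w.ofLp := by
  rw [EuclideanSpace.inner_eq_star_dotProduct, star_trivial, dotProduct_comm]

theorem adjoint_matrixCLM {k m : ℕ} (M : Matrix (Fin k) (Fin m) ℝ) :
    (matrixCLM M).adjoint = matrixCLM Mᵀ := by
  symm
  rw [ContinuousLinearMap.eq_adjoint_iff]
  intro v w
  rw [inner_eq_dotProduct_ofLp, inner_eq_dotProduct_ofLp, matrixCLM_apply, matrixCLM_apply,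
    Matrix.mulVec_transpose, ← Matrix.dotProduct_mulVec]

/-- A linear image of a Gaussian vector with identity covariance is standard Gaussian. -/
theorem hasLaw_stdGaussian_matrixCLM {k m : ℕ} {S : Matrix (Fin m) (Fin m) ℝ}
    (hS : S.PosSemidef) {B : Matrix (Fin k) (Fin m) ℝ} (hB : B * S * Bᵀ = 1)
    {X : Ω → EuclideanSpace ℝ (Fin m)} (hX : HasLaw X (multivariateGaussian 0 S) P) :
    HasLaw (fun ω => matrixCLM B (X ω)) (stdGaussian (EuclideanSpace ℝ (Fin k))) P := by
  refine HasLaw.fun_comp (μ := multivariateGaussian 0 S) ⟨by fun_prop, ?_⟩ hX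
  apply Measure.ext_of_charFun
  ext t
  rw [charFun_map_continuousLinearMap, charFun_multivariateGaussian hS, charFun_stdGaussian,
    inner_zero_right, adjoint_matrixCLM, matrixCLM_apply]
  have : (Bᵀ *ᵥ t.ofLp) ⬝ᵥ S *ᵥ (Bᵀ *ᵥ t.ofLp) = ‖t‖ ^ 2 := by
    rw [Matrix.mulVec_mulVec, Matrix.mulVec_transpose, ← Matrix.dotProduct_mulVec,
      Matrix.mulVec_mulVec, ← Matrix.mul_assoc, hB, Matrix.one_mulVec, ← l2_sq]
    rfl
  rw [this]
  push_cast
  ring_nf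

/-- A unit combination of independent standard Gaussian vectors is standard Gaussian. -/
theorem hasLaw_stdGaussian_sum_smul [IsProbabilityMeasure P] {k n : ℕ}
    {X : Fin n → Ω → EuclideanSpace ℝ (Fin k)}
    (hX : ∀ i, HasLaw (X i) (stdGaussian (EuclideanSpace ℝ (Fin k))) P) (hind : iIndepFun X P)
    {v : EuclideanSpace ℝ (Fin n)} (hv : ‖v‖ = 1) :
    HasLaw (fun ω => ∑ i, v i • X i ω) (stdGaussian (EuclideanSpace ℝ (Fin k))) P := by
  have hmeas : ∀ i, AEMeasurable (fun ω => v i • X i ω) P := fun i =>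
    (hX i).aemeasurable.const_smul (v i)
  have hind' : iIndepFun (fun i ω => v i • X i ω) P :=
    hind.comp (fun i x => v i • x) (fun i => by fun_prop)
  refine ⟨Finset.aemeasurable_fun_sum _ fun i _ => hmeas i, ?_⟩
  have : IsProbabilityMeasure (P.map fun ω => ∑ i, v i • X i ω) :=
    Measure.isProbabilityMeasure_map (Finset.aemeasurable_fun_sum _ fun i _ => hmeas i)
  apply Measure.ext_of_charFun
  ext t
  rw [hind'.charFun_map_fun_sum_eq_prod hmeas, Finset.prod_apply]
  have hterm : ∀ i, charFun (P.map fun ω => v i • X i ω) t =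
      Complex.exp (-(‖v i • t‖ : ℂ) ^ 2 / 2) := fun i => by
    rw [charFun_map_smul_comp (hX i).aemeasurable, (hX i).map_eq, charFun_stdGaussian]
  rw [Finset.prod_congr rfl fun i _ => hterm i, charFun_stdGaussian, ← Complex.exp_sum]
  congr 1
  have hnorm : ∀ i, (‖v i • t‖ : ℂ) ^ 2 = (v i : ℂ) ^ 2 * (‖t‖ : ℂ) ^ 2 := fun i => by
    rw [norm_smul, Complex.ofReal_mul, mul_pow, ← Complex.ofReal_pow, Real.norm_eq_abs, sq_abs,
      Complex.ofReal_pow]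
  simp_rw [hnorm]
  have h1 : ∑ i, v i ^ 2 = 1 := by rw [← EuclideanSpace.real_norm_sq_eq, hv, one_pow]
  have h2 : ∑ i, (v i : ℂ) ^ 2 = 1 := by exact_mod_cast h1
  simp_rw [← Finset.sum_div, Finset.sum_neg_distrib, ← Finset.sum_mul, h2, one_mul]

/-- The vector of unit-variance projections of independent Gaussian vectors is standard Gaussian. -/
theorem hasLaw_stdGaussian_dotProduct [IsProbabilityMeasure P] {m n : ℕ}
    {S : Matrix (Fin m) (Fin m) ℝ} (hS : S.PosSemidef)
    {X : Fin n → Ω → EuclideanSpace ℝ (Fin m)}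
    (hX : ∀ i, HasLaw (X i) (multivariateGaussian 0 S) P) (hind : iIndepFun X P)
    {w : Fin m → ℝ} (hw : w ⬝ᵥ S *ᵥ w = 1) :
    HasLaw (fun ω => WithLp.toLp 2 fun i => (X i ω).ofLp ⬝ᵥ w)
      (stdGaussian (EuclideanSpace ℝ (Fin n))) P := by
  let ℓ : EuclideanSpace ℝ (Fin m) →L[ℝ] ℝ := innerSL ℝ (WithLp.toLp 2 w)
  have hℓ : ∀ x, ℓ x = x.ofLp ⬝ᵥ w := fun x => by
    rw [innerSL_apply_apply, inner_eq_dotProduct_ofLp, dotProduct_comm]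
  have hlaw : ∀ i, HasLaw (fun ω => (X i ω).ofLp ⬝ᵥ w) (gaussianReal 0 1) P := fun i => by
    simp_rw [← hℓ]
    refine HasLaw.fun_comp (μ := multivariateGaussian 0 S) ⟨by fun_prop, ?_⟩ (hX i)
    apply Measure.ext_of_charFun
    ext t
    have hadj : ℓ.adjoint t = t • WithLp.toLp 2 w := by
      refine ext_inner_left ℝ fun v => ?_
      rw [ContinuousLinearMap.adjoint_inner_right, innerSL_apply_apply, inner_smul_right,
        real_inner_comm v]
      simp
    rw [charFun_map_continuousLinearMap, charFun_multivariateGaussian hS, charFun_gaussianReal,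
      inner_zero_right, hadj]
    have : (t • WithLp.toLp 2 w).ofLp ⬝ᵥ S *ᵥ (t • WithLp.toLp 2 w).ofLp = t ^ 2 := by
      rw [WithLp.ofLp_smul, Matrix.mulVec_smul, smul_dotProduct, dotProduct_smul, hw]
      simp [sq]
    rw [this]
    simp
  have hind' : iIndepFun (fun i ω => (X i ω).ofLp ⬝ᵥ w) P := by
    have := hind.comp (fun _ x => ℓ x) (fun i => by fun_prop)
    simpa only [Function.comp_def, hℓ] using this
  rw [← map_pi_eq_stdGaussian]
  exact HasLaw.fun_comp ⟨by fun_prop, rfl⟩ (hind'.hasLaw_pi hlaw)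

theorem measureReal_noise_le [IsProbabilityMeasure P] {n : ℕ} {a : ℝ} (ha : 0 ≤ a)
    {ε : Ω → EuclideanSpace ℝ (Fin n)}
    (hε : HasLaw ε (multivariateGaussian 0 (a • (1 : Matrix (Fin n) (Fin n) ℝ))) P) :
    P.real {ω | 3 / 2 * √n * √a < ‖ε ω‖} ≤ (Real.exp (-5 / 8) * (3 / 2)) ^ n := by
  rcases ha.eq_or_lt with rfl | ha
  -- At zero variance the noise is a point mass at the origin and cannot be rescaled to a standard
  -- Gaussian.
  · rw [zero_smul] at hε
    have h0 : multivariateGaussian (0 : EuclideanSpace ℝ (Fin n)) 0 = Measure.dirac 0 := by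
      simp [multivariateGaussian, CFC.sqrt_zero]
    rw [hε.measureReal_eq (p := fun g => 3 / 2 * √n * √0 < ‖g‖)
      (measurableSet_lt measurable_const measurable_norm), h0]
    simp only [Real.sqrt_zero, mul_zero, norm_pos_iff, Measure.real]
    rw [Measure.dirac_apply' _ (by measurability)]
    simp
    positivity
  · have hsa : 0 < √a := Real.sqrt_pos.2 ha
    have hlaw := hasLaw_stdGaussian_matrixCLM (S := a • 1) (B := (√a)⁻¹ • 1)
      (Matrix.PosSemidef.one.smul ha.le) (by
        simp only [Matrix.smul_mul, Matrix.transpose_smul, Matrix.mul_smul, Matrix.mul_one, smul_smul]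
        have : (√a)⁻¹ * (a * (√a)⁻¹) = 1 := by
          field_simp
          rw [Real.sq_sqrt ha.le]
        rw [this, one_smul, Matrix.transpose_one, Matrix.one_mul]) hε
    refine le_trans (le_of_eq ?_) (stdGaussian_norm_ge_le (N := n))
    rw [← hlaw.measureReal_eq (p := fun g => 3 / 2 * √n < ‖g‖)
      (measurableSet_lt measurable_const measurable_norm)]
    congr 1 with ω
    have : matrixCLM ((√a)⁻¹ • (1 : Matrix (Fin n) (Fin n) ℝ)) (ε ω) = (√a)⁻¹ • ε ω := by
      rw [matrixCLM_apply, Matrix.smul_mulVec, Matrix.one_mulVec]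
      rfl
    simp only [Set.mem_ofPred_eq]
    rw [this, norm_smul, norm_inv, Real.norm_of_nonneg hsa.le, inv_mul_eq_div, lt_div_iff₀ hsa]

end Laws

/-! ### Whitening by an explicit inverse square root of Σ -/

section Whitening

variable {n d p : ℕ} {W : Matrix (Fin p) (Fin d) ℝ} {s : ℝ}

theorem posSemidef_covMatrix : (covMatrix W).PosSemidef := by
  have := Matrix.posSemidef_self_mul_conjTranspose W
  rw [Matrix.conjTranspose_eq_transpose_of_trivial] at this
  exact this.add Matrix.PosSemidef.one

/-- The matrix `1 - κ W Wᵀ`. -/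
def shrink (W : Matrix (Fin p) (Fin d) ℝ) (κ : ℝ) : Matrix (Fin p) (Fin p) ℝ :=
  1 - κ • (W * Wᵀ)

theorem transpose_shrink (κ : ℝ) : (shrink W κ)ᵀ = shrink W κ := by
  simp [shrink]

theorem range_mul_self (hW : Wᵀ * W = s • 1) : (W * Wᵀ) * (W * Wᵀ) = s • (W * Wᵀ) := by
  rw [Matrix.mul_assoc, ← Matrix.mul_assoc Wᵀ, hW]
  simp

/-- `shrink W κ` acts by 1 - κs ∈ [0, 1] on the range of W and trivially on its complement. Used
both for the whitening factor and for κ = s⁻¹, the projection onto the complement. -/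
theorem l2_shrink_mulVec_le (hW : Wᵀ * W = s • 1) {κ : ℝ} (hκ : 0 ≤ κ) (hκs : κ * s ≤ 1)
    (z : Fin p → ℝ) : l2 (shrink W κ *ᵥ z) ≤ l2 z := by
  have h : l2 (shrink W κ *ᵥ z) ^ 2 = l2 z ^ 2 - κ * (2 - κ * s) * l2 (Wᵀ *ᵥ z) ^ 2 := by
    have h1 : (shrink W κ)ᵀ * (shrink W κ) = 1 - (κ * (2 - κ * s)) • (W * Wᵀ) := by
      rw [transpose_shrink, shrink, sub_mul, Matrix.one_mul, mul_sub, Matrix.mul_one,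
        Matrix.smul_mul, Matrix.mul_smul, range_mul_self hW]
      module
    have h2 := l2_sq_transpose_mulVec (shrink W κ)ᵀ z
    rw [Matrix.transpose_transpose, h1, Matrix.sub_mulVec, Matrix.one_mulVec,
      Matrix.smul_mulVec, dotProduct_sub, dotProduct_smul, ← l2_sq_transpose_mulVec, ← l2_sq] at h2
    exact h2
  refine abs_le_of_sq_le_sq' ?_ (l2_nonneg _) |>.2
  have : 0 ≤ κ * (2 - κ * s) * l2 (Wᵀ *ᵥ z) ^ 2 := by
    have : 0 ≤ 2 - κ * s := by linarith
    positivity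
  linarith

/-- The shrinkage factor for which `shrink W` is the inverse square root of the covariance. -/
noncomputable def whitenFactor (s : ℝ) : ℝ := (1 - (√(1 + s))⁻¹) / s

theorem whitenFactor_mul (hs : 0 < s) : whitenFactor s * s = 1 - (√(1 + s))⁻¹ :=
  div_mul_cancel₀ _ hs.ne'

theorem whitenFactor_nonneg (hs : 0 < s) : 0 ≤ whitenFactor s := by
  refine div_nonneg (sub_nonneg.2 (inv_le_one_of_one_le₀ ?_)) hs.le
  exact Real.one_le_sqrt.2 (by linarith)

theorem shrink_mul_covMatrix_mul (hW : Wᵀ * W = s • 1) (hs : 0 < s) :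
    shrink W (whitenFactor s) * covMatrix W * (shrink W (whitenFactor s))ᵀ = 1 := by
  have hκ := whitenFactor_mul hs
  have hρ : (√(1 + s))⁻¹ ^ 2 * (1 + s) = 1 := by
    rw [inv_pow, Real.sq_sqrt (by positivity), inv_mul_cancel₀ (by positivity)]
  have hρ' : (√(1 + s))⁻¹ = 1 - whitenFactor s * s := by linarith
  rw [hρ'] at hρ
  rw [transpose_shrink]
  set κ := whitenFactor s
  -- Multiplied by s, the left side is (1 - κs)²(1 + s) - 1.
  have hcoef : 1 - 2 * κ * (1 + s) + κ ^ 2 * s * (1 + s) = 0 := by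
    refine (mul_eq_zero.1 ?_).resolve_left hs.ne'
    linear_combination hρ
  have hQ := range_mul_self hW
  have : shrink W κ * covMatrix W * shrink W κ =
      1 + (1 - 2 * κ * (1 + s) + κ ^ 2 * s * (1 + s)) • (W * Wᵀ) := by
    rw [shrink, covMatrix]
    generalize W * Wᵀ = Q at hQ
    simp only [sub_mul, mul_sub, add_mul, mul_add, Matrix.one_mul, Matrix.mul_one,
      Matrix.smul_mul, Matrix.mul_smul, hQ, smul_smul]
    module
  rw [this, hcoef, zero_smul, add_zero]

theorem shrink_inv_mul_shrink (hW : Wᵀ * W = s • 1) (hs : 0 < s) (κ : ℝ) :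
    shrink W s⁻¹ * shrink W κ = shrink W s⁻¹ := by
  have hQ := range_mul_self hW
  rw [shrink, shrink]
  generalize W * Wᵀ = Q at hQ
  simp only [sub_mul, mul_sub, Matrix.one_mul, Matrix.mul_one,
      Matrix.smul_mul, Matrix.mul_smul, hQ, smul_smul]
  rw [inv_mul_cancel₀ hs.ne', mul_one]
  abel

/-- Whitening is a contraction because Σ ≥ I, so a lower bound after whitening survives without it.
-/
theorem le_l2_transpose_of_whitened (hW : Wᵀ * W = s • 1) (hs : 0 < s)
    {A : Matrix (Fin n) (Fin p) ℝ} {a : ℝ}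
    (h : ∀ v, a * l2 v ≤ l2 (shrink W (whitenFactor s) *ᵥ (Aᵀ *ᵥ v))) (v : Fin n → ℝ) :
    a * l2 v ≤ l2 (Aᵀ *ᵥ v) := by
  refine (h v).trans (l2_shrink_mulVec_le hW (whitenFactor_nonneg hs) ?_ _)
  rw [whitenFactor_mul hs]
  have : 0 ≤ (√(1 + s))⁻¹ := by positivity
  linarith

/-- On the complement of the range of W, Σ is the identity and whitening does nothing
(`shrink_inv_mul_shrink`); the whitened upper bound thus transfers, by duality, with no factor of s.
-/
theorem l2_complement_le_of_whitened (hW : Wᵀ * W = s • 1) (hs : 0 < s)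
    {A : Matrix (Fin n) (Fin p) ℝ} {K : ℝ} (hK : 0 ≤ K)
    (h : ∀ v, l2 (shrink W (whitenFactor s) *ᵥ (Aᵀ *ᵥ v)) ≤ K * l2 v) (b : Fin p → ℝ) :
    l2 (A *ᵥ (b - s⁻¹ • (W *ᵥ (Wᵀ *ᵥ b)))) ≤ K * l2 b := by
  have hD : b - s⁻¹ • (W *ᵥ (Wᵀ *ᵥ b)) = shrink W s⁻¹ *ᵥ b := by
    rw [shrink, Matrix.sub_mulVec, Matrix.one_mulVec, Matrix.smul_mulVec, Matrix.mulVec_mulVec]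
  rw [hD]
  set v := A *ᵥ (shrink W s⁻¹ *ᵥ b) with hv
  have h1 : l2 v ^ 2 ≤ l2 (shrink W s⁻¹ *ᵥ (Aᵀ *ᵥ v)) * l2 b := by
    have : l2 v ^ 2 = (shrink W s⁻¹ *ᵥ (Aᵀ *ᵥ v)) ⬝ᵥ b := by
      rw [l2_sq]
      conv_lhs => rhs; rw [hv]
      rw [Matrix.dotProduct_mulVec, Matrix.dotProduct_mulVec, ← Matrix.mulVec_transpose,
        ← Matrix.mulVec_transpose, transpose_shrink]
    rw [this]
    exact dotProduct_le_l2_mul_l2 _ _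
  have h2 : l2 (shrink W s⁻¹ *ᵥ (Aᵀ *ᵥ v)) ≤ K * l2 v := by
    rw [← shrink_inv_mul_shrink hW hs (whitenFactor s), ← Matrix.mulVec_mulVec]
    exact (l2_shrink_mulVec_le hW (by positivity) (inv_mul_cancel₀ hs.ne').le _).trans (h v)
  rcases (l2_nonneg v).eq_or_lt with h0 | h0
  · rw [← h0]; exact mul_nonneg hK (l2_nonneg _)
  · refine le_of_mul_le_mul_right ?_ h0
    nlinarith [mul_le_mul_of_nonneg_right h2 (l2_nonneg b)]

end Whitening

/-! ### Probability of a badly conditioned design -/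

section Design

variable {Ω : Type*} [MeasurableSpace Ω] {P : Measure Ω} [IsProbabilityMeasure P]
  {n d p : ℕ} {W : Matrix (Fin p) (Fin d) ℝ} {s : ℝ}
  {x : Fin n → Ω → EuclideanSpace ℝ (Fin p)}

/-- Whitened rows are independent standard Gaussians, so a unit combination of them is standard
Gaussian in dimension p. -/
theorem measureReal_whitened_design_le (hW : Wᵀ * W = s • 1) (hs : 0 < s) (hnp : 20 * n ≤ p)
    (hx : ∀ i, HasLaw (x i) (multivariateGaussian 0 (covMatrix W)) P) (hind : iIndepFun x P) :
    P.real {ω | ¬ ∀ v, 9 / 20 * √p * l2 v ≤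
        l2 (shrink W (whitenFactor s) *ᵥ ((dataMatrix fun i => x i ω)ᵀ *ᵥ v)) ∧
      l2 (shrink W (whitenFactor s) *ᵥ ((dataMatrix fun i => x i ω)ᵀ *ᵥ v)) ≤
        8 / 5 * √p * l2 v} ≤ 2 * (1 / 2) ^ n := by
  set T := shrink W (whitenFactor s) with hT
  refine (measureReal_mono (fun ω hω => ?_) (measure_ne_top _ _)).trans
    (measureReal_ill_conditioned_le P hnp
    (fun ω => matrixCLM (T * (dataMatrix fun i => x i ω)ᵀ)) fun v hv => ?_)
  · refine fun hall => hω fun v => ?_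
    have := hall (WithLp.toLp 2 v)
    rw [matrixCLM_apply, ← Matrix.mulVec_mulVec] at this
    exact this
  · have hlaw := fun i => hasLaw_stdGaussian_matrixCLM posSemidef_covMatrix
      (shrink_mul_covMatrix_mul hW hs) (hx i)
    have hind' : iIndepFun (fun i ω => matrixCLM T (x i ω)) P :=
      hind.comp (fun _ z => matrixCLM T z) (fun _ => by fun_prop)
    convert hasLaw_stdGaussian_sum_smul hlaw hind' hv using 2 with ω
    rw [matrixCLM_apply, ← Matrix.mulVec_mulVec]
    simp_rw [← map_smul]
    rw [← map_sum, matrixCLM_apply]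
    congr 2
    ext j
    simp [dataMatrix, Matrix.mulVec, dotProduct, mul_comm]

/-- For a unit vector u each row has variance uᵀWᵀΣWu = s(1+s) along Wu; dividing by its square root
makes AWu standard Gaussian in dimension n. -/
theorem measureReal_signal_design_le (hW : Wᵀ * W = s • 1) (hs : 0 < s) (hdn : 20 * d ≤ n)
    (hx : ∀ i, HasLaw (x i) (multivariateGaussian 0 (covMatrix W)) P) (hind : iIndepFun x P) :
    P.real {ω | ¬ ∀ u, 9 / 20 * √n * √(s * (1 + s)) * l2 u ≤
        l2 ((dataMatrix fun i => x i ω) *ᵥ (W *ᵥ u))} ≤ 2 * (1 / 2) ^ d := by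
  have hc : 0 < √(s * (1 + s)) := Real.sqrt_pos.2 (by positivity)
  set c := √(s * (1 + s)) with hcdef
  have hcsq : c ^ 2 = s * (1 + s) := Real.sq_sqrt (by positivity)
  refine (measureReal_mono (fun ω hω => ?_) (measure_ne_top _ _)).trans
    (measureReal_ill_conditioned_le P hdn
    (fun ω => matrixCLM (c⁻¹ • ((dataMatrix fun i => x i ω) * W))) fun u hu => ?_)
  · refine fun hall => hω fun u => ?_
    have := (hall (WithLp.toLp 2 u)).1
    rw [matrixCLM_apply, Matrix.smul_mulVec, ← Matrix.mulVec_mulVec] at this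
    change 9 / 20 * √n * l2 u ≤ l2 _ at this
    rw [l2_smul, abs_of_pos (by positivity), inv_mul_eq_div, le_div_iff₀ hc] at this
    linarith
  · have hu2 : l2 u.ofLp ^ 2 = 1 := by
      change ‖u‖ ^ 2 = 1
      rw [hu, one_pow]
    have hw : (c⁻¹ • (W *ᵥ u.ofLp)) ⬝ᵥ covMatrix W *ᵥ (c⁻¹ • (W *ᵥ u.ofLp)) = 1 := by
      have h1 : (W *ᵥ u.ofLp) ⬝ᵥ covMatrix W *ᵥ (W *ᵥ u.ofLp) = s * (1 + s) := by
        rw [covMatrix, Matrix.add_mulVec, Matrix.one_mulVec, dotProduct_add,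
          ← l2_sq_transpose_mulVec, ← l2_sq, l2_mulVec_sq hW, Matrix.mulVec_mulVec, hW,
          Matrix.smul_mulVec, Matrix.one_mulVec, l2_smul, mul_pow, hu2, sq_abs]
        ring
      rw [Matrix.mulVec_smul, smul_dotProduct, dotProduct_smul, h1, ← hcsq]
      simp only [smul_eq_mul]
      field_simp
    convert hasLaw_stdGaussian_dotProduct posSemidef_covMatrix hx hind hw using 2 with ω
    rw [matrixCLM_apply, Matrix.smul_mulVec, ← Matrix.mulVec_mulVec, ← Matrix.mulVec_smul]
    rfl

end Design

theorem half_pow_le_exp (k : ℕ) : (1 / 2 : ℝ) ^ k ≤ Real.exp (-(1 / 10) * k) := by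
  rw [mul_comm, Real.exp_nat_mul]
  refine pow_le_pow_left₀ (by norm_num) ?_ k
  linarith [Real.add_one_le_exp (-(1 / 10) : ℝ)]

theorem tail_pow_le_exp (k : ℕ) :
    (Real.exp (-5 / 8) * (3 / 2)) ^ k ≤ Real.exp (-(1 / 10) * k) := by
  rw [mul_comm (-(1 / 10) : ℝ), Real.exp_nat_mul]
  refine pow_le_pow_left₀ (by positivity) ?_ k
  have h : (-(1 / 10) : ℝ) = -5 / 8 + 21 / 40 := by norm_num
  rw [h, Real.exp_add]
  gcongr
  linarith [Real.add_one_le_exp (21 / 40 : ℝ)]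

/-- Subadditivity on a cover of the whole space, in place of a complement formula, requires no
measurability of either set. -/
theorem one_sub_le_measureReal_of_compl_subset {Ω : Type*} [MeasurableSpace Ω] (P : Measure Ω)
    [IsProbabilityMeasure P] {G B : Set Ω} {δ : ℝ} (h : Gᶜ ⊆ B) (hB : P.real B ≤ δ) :
    1 - δ ≤ P.real G := by
  have h1 : P.real (G ∪ B) ≤ P.real G + P.real B := measureReal_union_le _ _
  have h2 : G ∪ B = Set.univ := by
    rw [Set.eq_univ_iff_forall]
    intro ω
    by_cases hω : ω ∈ G
    · exact Or.inl hω
    · exact Or.inr (h hω)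
  rw [h2, probReal_univ] at h1
  linarith

end LatentRegression

theorem mainTheorem2 :
    ∃ c : ℝ, 0 < c ∧
      ∀ (n d p : ℕ) (γ : ℝ) (W : Matrix (Fin p) (Fin d) ℝ) (θ : EuclideanSpace ℝ (Fin d)),
        Wᵀ * W = ((p : ℝ) * γ) • (1 : Matrix (Fin d) (Fin d) ℝ) →
        d ≤ n → 20 * n ≤ p → 1 / √((n : ℝ) * d) ≤ γ →
        ∀ (Ω : Type*) [MeasurableSpace Ω] (P : Measure Ω) [IsProbabilityMeasure P]
          (x : Fin n → Ω → EuclideanSpace ℝ (Fin p)) (ε : Ω → EuclideanSpace ℝ (Fin n)),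
          LatentRegression.IsSingleTaskModel P W θ x ε →
          1 - 10 * Real.exp (-c * d) ≤
            P.real {ω |
              let A := LatentRegression.dataMatrix fun i => x i ω
              IsUnit (A * Aᵀ) ∧
                LatentRegression.risk W θ
                    (LatentRegression.minNormEstimator A
                      (LatentRegression.responses W θ A (ε ω))) ≤
                  (72 * √((d : ℝ) / n) + 18 * n / p) * ‖θ‖ ^ 2} := by
  refine ⟨1 / 10, by norm_num, fun n d p γ W θ hW hdn hnp hγ Ω _ P _ x ε hmodel => ?_⟩
  -- For d = 0 the claimed probability is 1 - 10 < 0.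
  rcases Nat.eq_zero_or_pos d with rfl | hd
  · simp only [Nat.cast_zero, mul_zero, Real.exp_zero]
    exact le_trans (by norm_num) measureReal_nonneg
  have hn : 0 < n := hd.trans_le hdn
  have hn' : (0 : ℝ) < n := by exact_mod_cast hn
  have hd' : (0 : ℝ) < d := by exact_mod_cast hd
  have hp' : (0 : ℝ) < p := by exact_mod_cast (show 0 < p by omega)
  have hγ0 : 0 < γ := lt_of_lt_of_le (by positivity) hγ
  obtain ⟨s, hs⟩ : ∃ s : ℝ, s = p * γ := ⟨_, rfl⟩
  have hs0 : 0 < s := by rw [hs]; positivity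
  rw [← hs] at hW
  have hτ0 : 0 ≤ ‖θ‖ ^ 2 / (1 + s) := by positivity
  let B₁ : Set Ω := {ω | ¬ ∀ v, 9 / 20 * √p * LatentRegression.l2 v ≤
        LatentRegression.l2 (LatentRegression.shrink W (LatentRegression.whitenFactor s) *ᵥ
          ((LatentRegression.dataMatrix fun i => x i ω)ᵀ *ᵥ v)) ∧
      LatentRegression.l2 (LatentRegression.shrink W (LatentRegression.whitenFactor s) *ᵥ
          ((LatentRegression.dataMatrix fun i => x i ω)ᵀ *ᵥ v)) ≤
        8 / 5 * √p * LatentRegression.l2 v}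
  -- Empty when n < 20d, where conditioning of AW is not needed. The three bad events together cost
  -- at most 5e^(-d/10).
  let B₂ : Set Ω := {ω | 20 * d ≤ n ∧
    ¬ ∀ u, 9 / 20 * √n * √(s * (1 + s)) * LatentRegression.l2 u ≤
        LatentRegression.l2 ((LatentRegression.dataMatrix fun i => x i ω) *ᵥ (W *ᵥ u))}
  let B₃ : Set Ω := {ω | 3 / 2 * √n * √(‖θ‖ ^ 2 / (1 + s)) < ‖ε ω‖}
  have hexp : Real.exp (-(1 / 10) * n) ≤ Real.exp (-(1 / 10) * d) := by
    have : (d : ℝ) ≤ n := by exact_mod_cast hdn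
    exact Real.exp_le_exp.2 (by linarith)
  have h₁ : P.real B₁ ≤ 2 * Real.exp (-(1 / 10) * d) := by
    refine (LatentRegression.measureReal_whitened_design_le hW hs0 hnp hmodel.law_row
      hmodel.indep_rows).trans ?_
    linarith [LatentRegression.half_pow_le_exp n]
  have h₂ : P.real B₂ ≤ 2 * Real.exp (-(1 / 10) * d) := by
    by_cases hdn20 : 20 * d ≤ n
    · have := LatentRegression.measureReal_signal_design_le hW hs0 hdn20 hmodel.law_row
        hmodel.indep_rows
      simp only [B₂, hdn20, true_and]
      linarith [LatentRegression.half_pow_le_exp d]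
    · simp only [B₂, hdn20, false_and, Set.ofPred_false, measureReal_empty]
      positivity
  have h₃ : P.real B₃ ≤ Real.exp (-(1 / 10) * d) := by
    have hlaw := hmodel.law_noise
    rw [LatentRegression.noiseVar_eq hW hs0] at hlaw
    exact (LatentRegression.measureReal_noise_le hτ0 hlaw).trans
      ((LatentRegression.tail_pow_le_exp n).trans hexp)
  refine LatentRegression.one_sub_le_measureReal_of_compl_subset P (B := B₁ ∪ B₂ ∪ B₃)
    (fun ω hω => ?_) ?_
  · by_contra hgood
    simp only [B₁, B₂, B₃, Set.mem_union, Set.mem_ofPred_eq, not_or, not_not, not_and,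
      not_lt] at hgood
    obtain ⟨⟨g₁, g₂⟩, g₃⟩ := hgood
    have hA := LatentRegression.le_l2_transpose_of_whitened hW hs0 fun v => (g₁ v).1
    have hupp := LatentRegression.l2_complement_le_of_whitened hW hs0 (by positivity)
      fun v => (g₁ v).2
    refine hω ⟨LatentRegression.isUnit_mul_transpose_of_le_l2 (by positivity) hA, ?_⟩
    exact LatentRegression.risk_minNormEstimator_le hd hdn hnp hγ hs hW θ hA
      (ε := (ε ω).ofLp) g₃ g₂ hupp
  · have h4 := measureReal_union_le (μ := P) (B₁ ∪ B₂) B₃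
    have h5 := measureReal_union_le (μ := P) B₁ B₂
    have := Real.exp_pos (-(1 / 10) * (d : ℝ))
    linarith
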